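/- All graphs are finite and simple. For a graph $G$, let $\omega(G)$, $\chi(G)$ and $\alpha(G)$ be its clique number, chromatic number and independence number. Let $c(G)$ be its cop number: the least $k$ such that $k$ cops have a winning strategy in the game of Cops and Robbers on $G$. In this game the cops first choose their starting vertices (several cops may share a vertex), then the robber chooses his; afterwards the cops and the robber alternate turns, the cops first. On the cops' turn each cop stays put or moves to an adjacent vertex, and on the robber's turn he stays put or moves to an adjacent vertex. The cops win if after finitely many moves some cop moves onto (or stays on) the vertex occupied by the robber. A graph is $H$-free if it has no induced subgraph isomorphic to $H$. For a class $\mathcal{G}$ of graphs, almost every graph in $\mathcal{G}$ has a property $P$ if the proportion of graphs with property $P$ among the graphs in $\mathcal{G}$ with vertex set $\{1,\dots,n\}$ tends to $1$ as $n\to\infty$. Write $K_m$ and $C_\ell$ for the complete graph on $m$ vertices and the cycle on $\ell$ vertices, and $mH$ for the disjoint union of $m$ copies of $H$. Assume that almost every $3K_1$-free graph $G$ satisfies $\chi(G)=\omega(G)$ and that almost every $2K_2$-free graph $G$ satisfies $\chi(G)=\omega(G)$. Let $\ell\in\{3,4\}$. Then almost every $C_\ell$-free graph $G$ satisfies $c(G)<\alpha(G)$.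 -/

import Mathlib

open Filter Topology

/-! ### The game of Cops and Robbers -/

/-- The first `t` positions of the robber, the most recent one first. -/
def robberHistory {V : Type*} (r : ℕ → V) : ℕ → List V
  | 0 => []
  | t + 1 => r t :: robberHistory r t

/-- A (deterministic, history-dependent) strategy for `k` cops on `G`. `pos h` gives the positions of
the cops after they have responded to the list `h` of all the positions taken by the robber so far
(most recent first). In particular `pos []` is the initial placement, chosen before the
robber's. On each of their turns, every cop passes or moves to an adjacent vertex. -/
structure CopStrategy {V : Type*} (G : SimpleGraph V) (k : ℕ) where
  pos : List V → Fin k → V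
  legal : ∀ (h : List V) (v : V) (i : Fin k),
    pos (v :: h) i = pos h i ∨ G.Adj (pos h i) (pos (v :: h) i)

/-- The robber's trajectory `r` is legal if on each turn he passes or moves to an adjacent vertex;
`r 0` is his initial placement. -/
def IsRobberPlay {V : Type*} (G : SimpleGraph V) (r : ℕ → V) : Prop :=
  ∀ t, r (t + 1) = r t ∨ G.Adj (r t) (r (t + 1))

/-- A strategy of the cops is winning if, whatever the robber does, on some turn of the cops
a cop moves onto (or stays on) the vertex currently occupied by the robber. -/
def CopStrategy.IsWinning {V : Type*} {G : SimpleGraph V} {k : ℕ} (S : CopStrategy G k) : Prop :=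
  ∀ r : ℕ → V, IsRobberPlay G r → ∃ (t : ℕ) (i : Fin k), S.pos (robberHistory r (t + 1)) i = r t

/-- The cop number `c(G)`: the least number of cops that have a winning strategy. -/
noncomputable def copNumber {V : Type*} (G : SimpleGraph V) : ℕ :=
  sInf {k : ℕ | ∃ S : CopStrategy G k, S.IsWinning}

/-! ### Forbidden induced subgraphs and typical graphs -/

/-- The disjoint union `mG` of `m` copies of `G`. -/
def disjointCopies {V : Type*} (m : ℕ) (G : SimpleGraph V) : SimpleGraph (Fin m × V) where
  Adj p q := p.1 = q.1 ∧ G.Adj p.2 q.2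
  symm := ⟨fun _ _ h => ⟨h.1.symm, h.2.symm⟩⟩
  loopless := ⟨fun _ h => G.loopless.irrefl _ h.2⟩

/-- `G` is `H`-free: no induced subgraph of `G` is isomorphic to `H`. -/
def IndFree {W V : Type*} (H : SimpleGraph W) (G : SimpleGraph V) : Prop :=
  ¬ H.IsIndContained G

/-- Almost every graph of the class `C` has the property `P`: the proportion, among the
graphs on the vertex set `Fin n` that belong to `C`, of those with `P` tends to `1` as
`n` tends to infinity. -/
def AlmostEvery (C P : ∀ n : ℕ, SimpleGraph (Fin n) → Prop) : Prop :=
  Tendsto (fun n : ℕ =>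
      ({G : SimpleGraph (Fin n) | C n G ∧ P n G}.ncard : ℝ) /
        ({G : SimpleGraph (Fin n) | C n G}.ncard : ℝ))
    atTop (𝓝 1)

/-! Complementation turns the two assumptions into a cover of almost every $C_\ell$-free graph by
$\alpha(G)$ cliques (`AlmostEvery.exists_clique_cover`). One cop per clique would win at once; the
point is to save a cop by handling two cliques with one cop, or three with two. For $\ell=3$ this
works near any vertex of degree at least three (`copNumber_lt_of_triangleFree`), for $\ell=4$ near
any edge between two cliques (`copNumber_lt_of_c4Free`). The exceptions have maximum degree at most
two, or are disjoint unions of cliques, so there are at most $n^{2n}$ of them. Bipartite and split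
graphs give at least $2^{\lfloor n^2/4\rfloor}$ graphs in the class, so the exceptions are
negligible (`AlmostEvery.of_few_exceptions`). -/

/-! ### Cop strategies from clique covers -/

/-- `y` lies in the closed neighbourhood of `x`. -/
def SimpleGraph.Near {V : Type*} (G : SimpleGraph V) (x y : V) : Prop :=
  x = y ∨ G.Adj x y

open Classical in
/-- Cops start at `p`, answer the placement `x` of the robber by moving to `q x`, and from then on
every cop captures the robber if he can and stays put otherwise. -/
noncomputable def greedyPos {V ι : Type*} (G : SimpleGraph V) (p : ι → V) (q : V → ι → V) :
    List V → ι → V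
  | [] => p
  | [x] => q x
  | y :: x :: h => fun i =>
      if G.Near (greedyPos G p q (x :: h) i) y then y else greedyPos G p q (x :: h) i

/-- If the cops can answer every placement `x` of the robber by capturing him or by dominating the
closed neighbourhood of `x`, then they win. -/
lemma copNumber_le_of_forall_answer {V ι : Type*} [Fintype ι] (G : SimpleGraph V) (p : ι → V)
    (h : ∀ x, ∃ q : ι → V, (∀ i, G.Near (p i) (q i)) ∧
      ((∃ i, q i = x) ∨ ∀ y, G.Near x y → ∃ i, G.Near (q i) y)) :
    copNumber G ≤ Fintype.card ι := by
  classical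
  choose q hq hwin using h
  let e := (Fintype.equivFin ι).symm
  refine Nat.sInf_le ⟨⟨fun l i => greedyPos G p q l (e i), ?_⟩, ?_⟩
  · intro l v i
    match l with
    | [] => exact (hq v (e i)).imp Eq.symm id
    | x :: l =>
      simp only [greedyPos]
      split_ifs with hn
      · exact hn.imp Eq.symm id
      · exact Or.inl rfl
  · intro r hr
    rcases hwin (r 0) with ⟨i, hi⟩ | hd
    · exact ⟨0, e.symm i, by simp [robberHistory, greedyPos, hi]⟩
    · obtain ⟨i, hi⟩ := hd (r 1) ((hr 0).imp Eq.symm id)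
      exact ⟨1, e.symm i, by simp [robberHistory, greedyPos, hi]⟩

/-- The cop number is at most the size of a dominating set. -/
lemma copNumber_le_of_dominating {V ι : Type*} [Fintype ι] (G : SimpleGraph V) (p : ι → V)
    (h : ∀ x, ∃ i, G.Near (p i) x) : copNumber G ≤ Fintype.card ι := by
  classical
  refine copNumber_le_of_forall_answer G p fun x => ?_
  obtain ⟨i, hi⟩ := h x
  refine ⟨Function.update p i x, fun j => ?_, Or.inl ⟨i, by simp⟩⟩
  rcases eq_or_ne j i with rfl | hj
  · simpa using hi
  · simp [hj, SimpleGraph.Near]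

/-- Given a cover of the vertices by cliques (the fibres of `c`), one cop can take care of
two cliques `i₀`, `j₀` in which he can catch a robber in two moves. -/
lemma copNumber_lt_of_two_cliques {V : Type*} {k : ℕ} (G : SimpleGraph V) (c : V → Fin k)
    (hc : ∀ x y, c x = c y → G.Near x y) {i₀ j₀ : Fin k} (hij : i₀ ≠ j₀) (p : V)
    (h : ∀ x, c x = i₀ ∨ c x = j₀ → G.Near p x ∨
      ∃ q, G.Near p q ∧ ∀ y, G.Near x y → c y = i₀ ∨ c y = j₀ → G.Near q y) :
    copNumber G < k := by
  classical
  have : Nonempty V := ⟨p⟩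
  -- Empty fibres are allowed: `Function.invFun` then returns an arbitrary vertex, and that cop is
  -- not needed.
  let w : {i : Fin k // i ≠ i₀} → V := fun i => if i.1 = j₀ then p else Function.invFun c i.1
  have hw : ∀ x, c x ≠ i₀ → c x ≠ j₀ → ∃ i : {i : Fin k // i ≠ i₀}, i.1 ≠ j₀ ∧ G.Near (w i) x := by
    intro x h1 h2
    refine ⟨⟨c x, h1⟩, h2, ?_⟩
    simp only [w, h2, if_false]
    exact hc _ _ (Function.invFun_eq ⟨x, rfl⟩)
  have hj : w ⟨j₀, hij.symm⟩ = p := by simp [w]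
  have key : copNumber G ≤ Fintype.card {i : Fin k // i ≠ i₀} := by
    refine copNumber_le_of_forall_answer G w fun x => ?_
    by_cases hdom : ∃ i, G.Near (w i) x
    · obtain ⟨i, hi⟩ := hdom
      refine ⟨Function.update w i x, fun j => ?_, Or.inl ⟨i, by simp⟩⟩
      rcases eq_or_ne j i with rfl | hj
      · simpa using hi
      · simp [hj, SimpleGraph.Near]
    · push Not at hdom
      have hx : c x = i₀ ∨ c x = j₀ := by
        by_contra hcon
        push Not at hcon
        obtain ⟨i, -, hi⟩ := hw x hcon.1 hcon.2
        exact hdom i hi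
      rcases h x hx with hp | ⟨q, hpq, hq⟩
      · exact absurd (hj ▸ hp) (hdom _)
      · refine ⟨Function.update w ⟨j₀, hij.symm⟩ q, fun j => ?_, Or.inr fun y hy => ?_⟩
        · rcases eq_or_ne j ⟨j₀, hij.symm⟩ with rfl | hj'
          · simpa [hj] using hpq
          · simp [hj', SimpleGraph.Near]
        · by_cases hcy : c y = i₀ ∨ c y = j₀
          · exact ⟨⟨j₀, hij.symm⟩, by simpa using hq y hy hcy⟩
          · push Not at hcy
            obtain ⟨i, hi, hn⟩ := hw y hcy.1 hcy.2
            refine ⟨i, ?_⟩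
            rwa [Function.update_of_ne]
            exact fun h => hi (congrArg Subtype.val h)
  refine key.trans_lt ?_
  simpa using Fintype.card_subtype_lt (p := fun i : Fin k => i ≠ i₀) (x := i₀) (by simp)

/-- Given a cover of the vertices by cliques (the fibres of `c`), two cops can take care of
three cliques which are dominated by two vertices. -/
lemma copNumber_lt_of_three_cliques {V : Type*} {k : ℕ} (G : SimpleGraph V) (c : V → Fin k)
    (hc : ∀ x y, c x = c y → G.Near x y) {i₀ j₀ l₀ : Fin k} (hij : i₀ ≠ j₀) (hil : i₀ ≠ l₀)
    (hjl : j₀ ≠ l₀) (u v : V)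
    (h : ∀ x, c x = i₀ ∨ c x = j₀ ∨ c x = l₀ → G.Near u x ∨ G.Near v x) :
    copNumber G < k := by
  classical
  have : Nonempty V := ⟨u⟩
  have key : copNumber G ≤ Fintype.card {i : Fin k // i ≠ i₀} := by
    refine copNumber_le_of_dominating G
      (fun i => if i.1 = j₀ then u else if i.1 = l₀ then v else Function.invFun c i.1) fun x => ?_
    by_cases hx : c x = i₀ ∨ c x = j₀ ∨ c x = l₀
    · rcases h x hx with h | h
      · exact ⟨⟨j₀, hij.symm⟩, by simpa using h⟩
      · exact ⟨⟨l₀, hil.symm⟩, by simpa [hjl.symm] using h⟩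
    · push Not at hx
      refine ⟨⟨c x, hx.1⟩, ?_⟩
      simp only [hx.2.1, hx.2.2, if_false]
      exact hc _ _ (Function.invFun_eq ⟨x, rfl⟩)
  refine key.trans_lt ?_
  simpa using Fintype.card_subtype_lt (p := fun i : Fin k => i ≠ i₀) (x := i₀) (by simp)

/-! ### Forbidden cycles as adjacency conditions -/

lemma indFree_cycleGraph_three_iff {V : Type*} {G : SimpleGraph V} :
    IndFree (SimpleGraph.cycleGraph 3) G ↔
      ∀ x y z, G.Adj x y → G.Adj y z → ¬ G.Adj x z := by
  constructor
  · intro h x y z hxy hyz hxz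
    refine h ⟨⟨⟨![x, y, z], ?_⟩, ?_⟩⟩
    · intro i j hij
      fin_cases i <;> fin_cases j <;>
        simp_all [hxy.ne, hyz.ne, hxz.ne, hxy.ne', hyz.ne', hxz.ne']
    · intro i j
      change G.Adj (![x, y, z] i) (![x, y, z] j) ↔ _
      rw [SimpleGraph.cycleGraph_three_eq_top]
      fin_cases i <;> fin_cases j <;>
        simp [hxy, hyz, hxz, hxy.symm, hyz.symm, hxz.symm]
  · rintro h ⟨f⟩
    rw [SimpleGraph.cycleGraph_three_eq_top] at f
    exact h (f 0) (f 1) (f 2) (f.map_rel_iff.2 (by simp)) (f.map_rel_iff.2 (by simp))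
      (f.map_rel_iff.2 (by simp))

lemma indFree_cycleGraph_four_iff {V : Type*} {G : SimpleGraph V} :
    IndFree (SimpleGraph.cycleGraph 4) G ↔
      ∀ x y z w, x ≠ z → y ≠ w → G.Adj x y → G.Adj y z → G.Adj z w → G.Adj w x →
        G.Adj x z ∨ G.Adj y w := by
  constructor
  · intro h x y z w hne hne' hxy hyz hzw hwx
    by_contra hcon
    push Not at hcon
    obtain ⟨hxz, hyw⟩ := hcon
    have hzx : ¬ G.Adj z x := fun h => hxz h.symm
    have hwy : ¬ G.Adj w y := fun h => hyw h.symm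
    refine h ⟨⟨⟨![x, y, z, w], ?_⟩, ?_⟩⟩
    · intro i j hij
      fin_cases i <;> fin_cases j <;>
        simp_all [hxy.ne, hyz.ne, hzw.ne, hwx.ne, hxy.ne', hyz.ne', hzw.ne', hwx.ne', hne.symm,
          hne'.symm]
    · intro i j
      change G.Adj (![x, y, z, w] i) (![x, y, z, w] j) ↔ _
      rw [SimpleGraph.cycleGraph_adj]
      fin_cases i <;> fin_cases j <;>
        simp [hxy, hyz, hzw, hwx, hxy.symm, hyz.symm, hzw.symm, hwx.symm, hxz, hyw, hzx, hwy] <;>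
        decide
  · rintro h ⟨f⟩
    have hf : ∀ i j, G.Adj (f i) (f j) ↔ (SimpleGraph.cycleGraph 4).Adj i j :=
      fun i j => f.map_rel_iff
    have := h (f 0) (f 1) (f 2) (f 3) (f.injective.ne (by decide)) (f.injective.ne (by decide))
    simp only [hf] at this
    revert this
    simp only [SimpleGraph.cycleGraph_adj]
    decide

/-! ### Saving one cop -/

/-- Triangle-freeness leaves at most two vertices in each clique of the cover, so the argument only
concerns `v`, its possible partner `v'`, and the cliques of neighbours of `v`. -/
lemma copNumber_lt_of_triangleFree {V : Type*} {k : ℕ} {G : SimpleGraph V} (c : V → Fin k)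
    (hc : ∀ x y, c x = c y → G.Near x y) (hG : ∀ x y z, G.Adj x y → G.Adj y z → ¬ G.Adj x z)
    {v x y z : V} (hvx : G.Adj v x) (hvy : G.Adj v y) (hvz : G.Adj v z) (hxy : x ≠ y)
    (hxz : x ≠ z) (hyz : y ≠ z) : copNumber G < k := by
  by_cases hv : ∃ v', v' ≠ v ∧ c v' = c v
  · obtain ⟨v', hne, hcv⟩ := hv
    have hvv : G.Adj v v' := (hc v v' hcv.symm).resolve_left hne.symm
    obtain ⟨w₁, w₂, h12, h1, h2, hv1, hv2⟩ : ∃ w₁ w₂, w₁ ≠ w₂ ∧ w₁ ≠ v' ∧ w₂ ≠ v' ∧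
        G.Adj v w₁ ∧ G.Adj v w₂ := by
      by_cases h1 : x = v'
      · exact ⟨y, z, hyz, fun h => hxy (h1.trans h.symm), fun h => hxz (h1.trans h.symm), hvy, hvz⟩
      · by_cases h2 : y = v'
        · exact ⟨x, z, hxz, h1, fun h => hyz (h2.trans h.symm), hvx, hvz⟩
        · exact ⟨x, y, hxy, h1, h2, hvx, hvy⟩
    have hcol : ∀ w, w ≠ v' → G.Adj v w → c v ≠ c w := fun w hw hvw h =>
      hG v v' w hvv ((hc v' w (hcv.trans h)).resolve_left hw.symm) hvw
    have hc12 : c w₁ ≠ c w₂ := fun h => hG v w₁ w₂ hv1 ((hc _ _ h).resolve_left h12) hv2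
    -- A cop at `v` misses only `u` in the cliques of `v` and `w`. Against a robber at `u` he moves
    -- to `w`, which is near `v`, `w` and `u`; the remaining vertex `v'` is out of the robber's
    -- reach.
    have main : ∀ w, w ≠ v' → G.Adj v w →
        (∃ u, c u = c w ∧ u ≠ w ∧ ¬ G.Adj v' u) → copNumber G < k := by
      rintro w hw hvw ⟨u, hcu, huw, hvu⟩
      have hwu : G.Adj w u := (hc w u hcu.symm).resolve_left huw.symm
      refine copNumber_lt_of_two_cliques G c hc (hcol w hw hvw) v fun t ht => ?_
      rcases ht with ht | ht
      · exact Or.inl (hc _ _ ht.symm)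
      · by_cases htw : t = w
        · exact Or.inl (Or.inr (htw ▸ hvw))
        · have hwt : G.Adj w t := (hc w t ht.symm).resolve_left (Ne.symm htw)
          have htu : t = u := (hc t u (ht.trans hcu.symm)).resolve_right
            fun h => hG w t u hwt h hwu
          subst htu
          refine Or.inr ⟨w, Or.inr hvw, fun s hs hcs => ?_⟩
          rcases hcs with hcs | hcs
          · by_cases hsv : s = v
            · exact Or.inr (hsv ▸ hvw.symm)
            · have h3 : G.Adj v s := (hc _ _ hcs.symm).resolve_left (Ne.symm hsv)
              rcases hc v' s (hcv.trans hcs.symm) with rfl | h4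
              · rcases hs with rfl | hs
                · exact absurd (hcv.symm.trans ht) (hcol w hw hvw)
                · exact absurd hs.symm hvu
              · exact absurd h3 (hG v v' s hvv h4)
          · exact hc _ _ hcs.symm
    by_cases hu1 : ∃ u, c u = c w₁ ∧ u ≠ w₁ ∧ ¬ G.Adj v' u
    · exact main w₁ h1 hv1 hu1
    by_cases hu2 : ∃ u, c u = c w₂ ∧ u ≠ w₂ ∧ ¬ G.Adj v' u
    · exact main w₂ h2 hv2 hu2
    -- Now any partners of `w₁` and `w₂` are adjacent to `v'`, so `v` and `v'` dominate all three
    -- cliques.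
    push Not at hu1 hu2
    refine copNumber_lt_of_three_cliques G c hc (hcol w₁ h1 hv1) (hcol w₂ h2 hv2) hc12 v v'
      fun t ht => ?_
    rcases ht with ht | ht | ht
    · exact Or.inl (hc _ _ ht.symm)
    · by_cases htw : t = w₁
      · exact Or.inl (Or.inr (htw ▸ hv1))
      · exact Or.inr (Or.inr (hu1 t ht htw))
    · by_cases htw : t = w₂
      · exact Or.inl (Or.inr (htw ▸ hv2))
      · exact Or.inr (Or.inr (hu2 t ht htw))
  · push Not at hv
    have hcx : c v ≠ c x := fun h => hv x hvx.ne' h.symm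
    -- The clique of `v` is a singleton, so a cop at `x` dominates it together with his own clique.
    refine copNumber_lt_of_two_cliques G c hc hcx x fun t ht => Or.inl ?_
    rcases ht with ht | ht
    · have : t = v := by_contra fun h => hv t h ht
      exact Or.inr (this ▸ hvx.symm)
    · exact hc _ _ ht.symm

/-- Between two cliques of a $C_4$-free graph neighbourhoods are nested. A cop at a vertex `p` of
the first clique with the most neighbours in the second sees every vertex having a neighbour across;
any other robber in the second clique cannot cross while the cop moves there. -/
lemma copNumber_lt_of_c4Free {V : Type*} [Finite V] {k : ℕ} {G : SimpleGraph V} (c : V → Fin k)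
    (hc : ∀ x y, c x = c y → G.Near x y)
    (hG : ∀ x y z w, x ≠ z → y ≠ w → G.Adj x y → G.Adj y z → G.Adj z w → G.Adj w x →
        G.Adj x z ∨ G.Adj y w)
    {a b : V} (hab : G.Adj a b) (hcab : c a ≠ c b) : copNumber G < k := by
  obtain ⟨p, hp, hmax⟩ := Set.exists_max_image {x | c x = c a}
    (fun x => {y | c y = c b ∧ G.Adj x y}.ncard) (Set.toFinite _) ⟨a, rfl⟩
  have hnest : ∀ x y, c x = c a → c y = c b → G.Adj x y → G.Adj p y := by
    intro x y hx hy hxy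
    by_contra hpy
    -- By maximality `p` has a neighbour `z` across that `x` lacks, so `p`, `x`, `y`, `z` would
    -- induce a $C_4$.
    have hlt : ¬ {y | c y = c b ∧ G.Adj p y} ⊆ {y | c y = c b ∧ G.Adj x y} := by
      intro hsub
      have heq := Set.eq_of_subset_of_ncard_le hsub (hmax x hx) (Set.toFinite _)
      have : y ∈ {y | c y = c b ∧ G.Adj p y} := heq ▸ ⟨hy, hxy⟩
      exact hpy this.2
    obtain ⟨z, ⟨hz, hpz⟩, hxz⟩ := Set.not_subset.1 hlt
    have hxz' : ¬ G.Adj x z := fun h => hxz ⟨hz, h⟩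
    have hpx : G.Adj p x := (hc p x (hp.trans hx.symm)).resolve_left
      (by rintro rfl; exact hpy hxy)
    have hyz : G.Adj y z := (hc y z (hy.trans hz.symm)).resolve_left
      (by rintro rfl; exact hpy hpz)
    rcases hG p x y z (by rintro rfl; exact hcab (hp.symm.trans hy))
      (by rintro rfl; exact hcab (hx.symm.trans hz)) hpx hxy hyz hpz.symm with h | h
    · exact hpy h
    · exact hxz' h
  refine copNumber_lt_of_two_cliques G c hc hcab p fun x hx => ?_
  rcases hx with hx | hx
  · exact Or.inl (hc _ _ (hp.trans hx.symm))
  · by_cases hpx : G.Adj p x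
    · exact Or.inl (Or.inr hpx)
    · refine Or.inr ⟨b, Or.inr (hnest a b rfl rfl hab), fun y hy hcy => ?_⟩
      rcases hcy with hcy | hcy
      · rcases hy with rfl | hy
        · exact hc _ _ hx.symm
        · exact absurd (hnest y x hcy hx hy.symm) hpx
      · exact hc _ _ hcy.symm

/-! ### Counting the exceptions and the classes -/

/-- The set of all graphs on `V` obtained by joining `x` to `f x` and `g x` for two maps `f`, `g`. -/
def fewLinksGraphs (V : Type*) : Set (SimpleGraph V) :=
  Set.range fun f : (V → V) × (V → V) => SimpleGraph.fromRel fun x y => y = f.1 x ∨ y = f.2 x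

/-- The set of all graphs on `V` obtained by joining the vertices with the same image under some
map `f`. -/
def kernelGraphs (V : Type*) : Set (SimpleGraph V) :=
  Set.range fun f : V → V => SimpleGraph.fromRel fun x y => f x = f y

lemma ncard_range_le_card {α β : Type*} [Fintype α] (f : α → β) :
    (Set.range f).ncard ≤ Fintype.card α := by
  rw [← Set.image_univ, ← Nat.card_eq_fintype_card, ← Set.ncard_univ]
  exact Set.ncard_image_le

lemma ncard_fewLinksGraphs_le (n : ℕ) : (fewLinksGraphs (Fin n)).ncard ≤ n ^ (2 * n) := by
  refine (ncard_range_le_card _).trans ?_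
  simp [two_mul, pow_add]

lemma ncard_kernelGraphs_le (n : ℕ) : (kernelGraphs (Fin n)).ncard ≤ n ^ (2 * n) := by
  refine (ncard_range_le_card _).trans ?_
  rcases n.eq_zero_or_pos with rfl | hn
  · simp
  · simpa using Nat.pow_le_pow_right hn (by omega)

lemma mem_fewLinksGraphs {V : Type*} {G : SimpleGraph V}
    (h : ∀ v x y z, G.Adj v x → G.Adj v y → G.Adj v z → x ≠ y → x ≠ z → y = z) :
    G ∈ fewLinksGraphs V := by
  have key : ∀ v, ∃ a b, ∀ y, G.Adj v y ↔ v ≠ y ∧ (y = a ∨ y = b) := by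
    intro v
    by_cases hv : ∃ x, G.Adj v x
    · obtain ⟨x, hx⟩ := hv
      by_cases hx' : ∃ y, G.Adj v y ∧ x ≠ y
      · obtain ⟨y, hy, hxy⟩ := hx'
        refine ⟨x, y, fun z => ⟨fun hz => ⟨hz.ne, ?_⟩, ?_⟩⟩
        · by_cases hzx : x = z
          · exact Or.inl hzx.symm
          · exact Or.inr (h v x y z hx hy hz hxy hzx).symm
        · rintro ⟨-, rfl | rfl⟩ <;> assumption
      · push Not at hx'
        refine ⟨x, x, fun z => ⟨fun hz => ⟨hz.ne, Or.inl (hx' z hz).symm⟩, ?_⟩⟩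
        rintro ⟨-, rfl | rfl⟩ <;> assumption
    · push Not at hv
      -- `fromRel` discards loops, so the choice `v`, `v` encodes an isolated vertex.
      exact ⟨v, v, fun y => ⟨fun h => absurd h (hv y), fun h => absurd h.1.symm (by simpa using h.2)⟩⟩
  choose f g hfg using key
  refine ⟨(f, g), ?_⟩
  ext x y
  rw [SimpleGraph.fromRel_adj]
  constructor
  · rintro ⟨hne, h | h⟩
    · exact (hfg x y).2 ⟨hne, h⟩
    · exact ((hfg y x).2 ⟨hne.symm, h⟩).symm
  · exact fun h => ⟨h.ne, Or.inl ((hfg x y).1 h).2⟩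

lemma mem_kernelGraphs {V κ : Type*} {G : SimpleGraph V} (c : V → κ)
    (hc : ∀ x y, c x = c y → G.Near x y) (h : ∀ x y, G.Adj x y → c x = c y) :
    G ∈ kernelGraphs V := by
  rcases isEmpty_or_nonempty V with hV | hV
  · exact ⟨id, by ext x; exact hV.elim x⟩
  have hinv : ∀ x, c (Function.invFun c (c x)) = c x := fun x => Function.invFun_eq ⟨x, rfl⟩
  -- Replacing each colour by a representative vertex makes the count independent of the number of
  -- colours.
  refine ⟨fun x => Function.invFun c (c x), ?_⟩
  ext x y
  rw [SimpleGraph.fromRel_adj]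
  constructor
  · rintro ⟨hne, h | h⟩
    · exact (hc x y ((hinv x).symm.trans ((congrArg c h).trans (hinv y)))).resolve_left hne
    · exact (hc x y ((hinv x).symm.trans ((congrArg c h.symm).trans (hinv y)))).resolve_left hne
  · exact fun hxy => ⟨hxy.ne, Or.inl (by simp only [h x y hxy])⟩

/-- If `A` and `B` are disjoint, the graphs whose edges inside `A` are given by `R` and which have
arbitrary edges between `A` and `B`, and no others, are numerous. -/
lemma two_pow_le_ncard {V : Type*} [Fintype V] [DecidableEq V] (A B : Finset V)
    (hAB : Disjoint A B) (R : V → V → Prop) (hR : ∀ x y, R x y → x ∈ A ∧ y ∈ A)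
    (C : Set (SimpleGraph V))
    (h : ∀ S : Finset (V × V), S ⊆ A ×ˢ B → SimpleGraph.fromRel (fun x y => R x y ∨ (x, y) ∈ S) ∈ C) :
    2 ^ (A.card * B.card) ≤ C.ncard := by
  have hcard : ((A ×ˢ B).powerset : Set (Finset (V × V))).ncard = 2 ^ (A.card * B.card) := by
    rw [Set.ncard_coe_finset, Finset.card_powerset, Finset.card_product]
  rw [← hcard]
  refine Set.ncard_le_ncard_of_injOn
    (fun S => SimpleGraph.fromRel (fun x y => R x y ∨ (x, y) ∈ S)) ?_ ?_ (Set.toFinite _)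
  · intro S hS
    exact h S (Finset.mem_powerset.1 (Finset.mem_coe.1 hS))
  · have hmem : ∀ S : Finset (V × V), S ⊆ A ×ˢ B → ∀ x ∈ A, ∀ y ∈ B,
        ((SimpleGraph.fromRel (fun x y => R x y ∨ (x, y) ∈ S)).Adj x y ↔ (x, y) ∈ S) := by
      intro S hS x hx y hy
      have hyA : y ∉ A := fun h => Finset.disjoint_left.1 hAB h hy
      have h1 : ¬ R x y := fun h => hyA (hR _ _ h).2
      have h2 : ¬ R y x := fun h => hyA (hR _ _ h).1
      have h3 : (y, x) ∉ S := fun h => hyA (Finset.mem_product.1 (hS h)).1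
      have h4 : x ≠ y := fun h => hyA (h ▸ hx)
      simp [SimpleGraph.fromRel_adj, h1, h2, h3, h4]
    intro S hS T hT hST
    have hS' : S ⊆ A ×ˢ B := Finset.mem_powerset.1 (Finset.mem_coe.1 hS)
    have hT' : T ⊆ A ×ˢ B := Finset.mem_powerset.1 (Finset.mem_coe.1 hT)
    dsimp only at hST
    ext ⟨x, y⟩
    constructor
    · intro hxy
      obtain ⟨hx, hy⟩ := Finset.mem_product.1 (hS' hxy)
      rw [← hmem T hT' x hx y hy, ← hST]
      exact (hmem S hS' x hx y hy).2 hxy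
    · intro hxy
      obtain ⟨hx, hy⟩ := Finset.mem_product.1 (hT' hxy)
      rw [← hmem S hS' x hx y hy, hST]
      exact (hmem T hT' x hx y hy).2 hxy

lemma exists_disjoint_halves (n : ℕ) : ∃ A B : Finset (Fin n), Disjoint A B ∧
    A.card = n / 2 ∧ B.card = n - n / 2 := by
  obtain ⟨A, -, hA⟩ := Finset.exists_subset_card_eq
    (show n / 2 ≤ (Finset.univ : Finset (Fin n)).card by simpa using Nat.div_le_self n 2)
  exact ⟨A, Aᶜ, disjoint_compl_right, hA, by rw [Finset.card_compl, hA, Fintype.card_fin]⟩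

lemma two_pow_le_ncard_triangleFree (n : ℕ) : 2 ^ (n / 2 * (n - n / 2)) ≤
    {G : SimpleGraph (Fin n) | IndFree (SimpleGraph.cycleGraph 3) G}.ncard := by
  obtain ⟨A, B, hAB, hA, hB⟩ := exists_disjoint_halves n
  rw [← hB, ← hA]
  refine two_pow_le_ncard A B hAB (fun _ _ => False) (by simp) _ fun S hS => ?_
  refine indFree_cycleGraph_three_iff.2 fun x y z => ?_
  have hm : ∀ {x y}, (x, y) ∈ S → x ∈ A ∧ y ∉ A := fun h =>
    ⟨(Finset.mem_product.1 (hS h)).1, fun h' =>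
      Finset.disjoint_left.1 hAB h' (Finset.mem_product.1 (hS h)).2⟩
  simp only [SimpleGraph.fromRel_adj, false_or]
  rintro ⟨-, h1⟩ ⟨-, h2⟩ ⟨-, h3⟩
  rcases h1 with h1 | h1 <;> rcases h2 with h2 | h2 <;> rcases h3 with h3 | h3 <;>
    have h1 := hm h1 <;> have h2 := hm h2 <;> have h3 := hm h3 <;> tauto

/-- In a split graph with clique `A`, a vertex outside `A` has all its neighbours in `A`; so every
4-cycle has a chord. -/
lemma two_pow_le_ncard_c4Free (n : ℕ) : 2 ^ (n / 2 * (n - n / 2)) ≤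
    {G : SimpleGraph (Fin n) | IndFree (SimpleGraph.cycleGraph 4) G}.ncard := by
  obtain ⟨A, B, hAB, hA, hB⟩ := exists_disjoint_halves n
  rw [← hB, ← hA]
  refine two_pow_le_ncard A B hAB (fun x y => x ∈ A ∧ y ∈ A) (by simp) _ fun S hS => ?_
  have hm : ∀ {x y}, (x, y) ∈ S → x ∈ A ∧ y ∉ A := fun h =>
    ⟨(Finset.mem_product.1 (hS h)).1, fun h' =>
      Finset.disjoint_left.1 hAB h' (Finset.mem_product.1 (hS h)).2⟩
  set G := SimpleGraph.fromRel fun x y => (x ∈ A ∧ y ∈ A) ∨ (x, y) ∈ S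
  have hclique : ∀ {x y}, x ≠ y → x ∈ A → y ∈ A → G.Adj x y := fun hne hx hy =>
    (SimpleGraph.fromRel_adj _ _ _).2 ⟨hne, Or.inl (Or.inl ⟨hx, hy⟩)⟩
  have hcover : ∀ {x y}, G.Adj x y → x ∈ A ∨ y ∈ A := by
    intro x y h
    rcases ((SimpleGraph.fromRel_adj _ _ _).1 h).2 with (h | h) | (h | h)
    exacts [Or.inl h.1, Or.inl (hm h).1, Or.inl h.2, Or.inr (hm h).1]
  refine indFree_cycleGraph_four_iff.2 fun x y z w hxz hyw h1 h2 h3 h4 => ?_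
  by_cases hx : x ∈ A
  · by_cases hz : z ∈ A
    · exact Or.inl (hclique hxz hx hz)
    · exact Or.inr (hclique hyw ((hcover h2).resolve_right hz) ((hcover h3).resolve_left hz))
  · exact Or.inr (hclique hyw ((hcover h1).resolve_left hx) ((hcover h4).resolve_right hx))

/-! ### Complements and clique covers -/

def complCycleThreeIso : SimpleGraph.cycleGraph 3 ≃g
    (disjointCopies 3 (SimpleGraph.completeGraph (Fin 1)))ᶜ where
  toFun i := (i, 0)
  invFun p := p.1
  left_inv _ := rfl
  right_inv p := Prod.ext rfl (Subsingleton.elim _ _)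
  map_rel_iff' := by
    intro i j
    simp [SimpleGraph.cycleGraph_three_eq_top, disjointCopies]

/-- The two edges of $2K_2$ are the diagonals of the 4-cycle. -/
def complCycleFourIso : SimpleGraph.cycleGraph 4 ≃g
    (disjointCopies 2 (SimpleGraph.completeGraph (Fin 2)))ᶜ where
  toFun := ![(0, 0), (1, 0), (0, 1), (1, 1)]
  invFun p := ![![0, 2], ![1, 3]] p.1 p.2
  left_inv i := by fin_cases i <;> rfl
  right_inv p := by
    obtain ⟨i, j⟩ := p
    fin_cases i <;> fin_cases j <;> rfl
  map_rel_iff' := by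
    intro i j
    rw [SimpleGraph.cycleGraph_adj]
    change (disjointCopies 2 (SimpleGraph.completeGraph (Fin 2)))ᶜ.Adj
      (![(0, 0), (1, 0), (0, 1), (1, 1)] i) (![(0, 0), (1, 0), (0, 1), (1, 1)] j) ↔ _
    fin_cases i <;> fin_cases j <;> simp [disjointCopies] <;> decide

lemma indFree_compl_iff {V W W' : Type*} {H : SimpleGraph W} {K : SimpleGraph W'} (e : K ≃g Hᶜ)
    (G : SimpleGraph V) : IndFree H Gᶜ ↔ IndFree K G := by
  refine not_congr ?_
  rw [← SimpleGraph.compl_isIndContained_compl, compl_compl]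
  exact ⟨fun ⟨f⟩ => ⟨f.comp e.toEmbedding⟩, fun ⟨f⟩ => ⟨f.comp e.symm.toEmbedding⟩⟩

lemma ncard_setOf_compl {V : Type*} (p : SimpleGraph V → Prop) :
    {G : SimpleGraph V | p Gᶜ}.ncard = {G : SimpleGraph V | p G}.ncard := by
  rw [← Set.ncard_image_of_injective _ (compl_injective (α := SimpleGraph V))]
  congr 1
  ext G
  exact ⟨fun ⟨H, hH, h⟩ => h ▸ hH, fun h => ⟨Gᶜ, by simpa using h, compl_compl G⟩⟩

/-- Passing to complements turns a chromatic number equal to the clique number into a cover by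
`indepNum` cliques. -/
lemma AlmostEvery.exists_clique_cover {W W' : Type*} {H : SimpleGraph W} {K : SimpleGraph W'}
    (e : K ≃g Hᶜ)
    (h : AlmostEvery (fun _ G => IndFree H G) fun _ G => G.chromaticNumber = (G.cliqueNum : ℕ∞)) :
    AlmostEvery (fun _ G => IndFree K G) fun n G =>
      ∃ c : Fin n → Fin G.indepNum, ∀ x y, c x = c y → G.Near x y := by
  have key : ∀ (n : ℕ) (G : SimpleGraph (Fin n)), Gᶜ.chromaticNumber = (Gᶜ.cliqueNum : ℕ∞) →
      ∃ c : Fin n → Fin G.indepNum, ∀ x y, c x = c y → G.Near x y := by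
    intro n G hG
    rw [SimpleGraph.cliqueNum_compl] at hG
    obtain ⟨c⟩ := SimpleGraph.chromaticNumber_le_iff_colorable.1 hG.le
    refine ⟨c, fun x y hxy => or_iff_not_imp_left.2 fun hne => ?_⟩
    by_contra hadj
    exact c.valid ((SimpleGraph.compl_adj _ _ _).2 ⟨hne, hadj⟩) hxy
  refine tendsto_of_tendsto_of_tendsto_of_le_of_le h tendsto_const_nhds (fun n => ?_) fun n => ?_
  · have h1 := ncard_setOf_compl fun G : SimpleGraph (Fin n) => IndFree H G
    have h2 := ncard_setOf_compl fun G : SimpleGraph (Fin n) =>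
      IndFree H G ∧ G.chromaticNumber = (G.cliqueNum : ℕ∞)
    simp only [indFree_compl_iff e] at h1 h2
    dsimp only
    rw [← h1, ← h2]
    gcongr with G hG
    · exact Set.toFinite _
    · exact key n G
  · refine div_le_one_of_le₀ ?_ (by positivity)
    exact Nat.cast_le.2 (Set.ncard_le_ncard (fun G h => h.1) (Set.toFinite _))

/-! ### Asymptotics and conclusion -/

/-- The spare factor $2^n$ makes the proportion of exceptions at most $2^{-n}$. -/
lemma eventually_pow_le : ∀ᶠ n : ℕ in atTop, n ^ (2 * n) * 2 ^ n ≤ 2 ^ (n / 2 * (n - n / 2)) := by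
  have h := tendsto_pow_const_div_const_pow_of_one_lt 8 (one_lt_two : (1 : ℝ) < 2)
  have h' := h.eventually (gt_mem_nhds (show (0 : ℝ) < 1 / 32 by norm_num))
  filter_upwards [h'] with n hn
  rw [div_lt_div_iff₀ (by positivity) (by norm_num)] at hn
  have hn' : n ^ 8 * 32 ≤ 2 ^ n := by
    have : (n : ℝ) ^ 8 * 32 ≤ 2 ^ n := by linarith
    exact_mod_cast this
  -- Fourth powers clear the quarter in $\lfloor n^2/4\rfloor$, and a further factor $2^n$ absorbs
  -- the rounding; what remains is the $n$-th power of $32n^8\le 2^n$.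
  refine (Nat.pow_le_pow_iff_left (show 4 ≠ 0 by norm_num)).1 ?_
  have h1 : (n ^ (2 * n) * 2 ^ n) ^ 4 * 2 ^ n = (n ^ 8 * 32) ^ n := by
    rw [mul_pow, ← pow_mul, ← pow_mul, mul_assoc, ← pow_add, mul_pow, ← pow_mul,
      show (32 : ℕ) = 2 ^ 5 by norm_num, ← pow_mul]
    congr 2 <;> ring
  have h2 : n * n ≤ n / 2 * (n - n / 2) * 4 + n := by
    have h3 : n / 2 + n / 2 ≤ n := by omega
    have h4 : n ≤ n / 2 + n / 2 + 1 := by omega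
    obtain ⟨m, hm⟩ : ∃ m, m = n / 2 := ⟨_, rfl⟩
    rw [← hm] at h3 h4 ⊢
    obtain rfl | rfl : n = m + m ∨ n = m + m + 1 := by omega
    · rw [Nat.add_sub_cancel]; nlinarith
    · rw [show m + m + 1 - m = m + 1 by omega]; nlinarith
  have h5 : (n ^ (2 * n) * 2 ^ n) ^ 4 * 2 ^ n ≤ (2 ^ (n / 2 * (n - n / 2))) ^ 4 * 2 ^ n := by
    rw [h1, ← pow_mul, ← pow_add]
    calc (n ^ 8 * 32) ^ n ≤ (2 ^ n) ^ n := Nat.pow_le_pow_left hn' n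
      _ = 2 ^ (n * n) := (pow_mul _ _ _).symm
      _ ≤ _ := Nat.pow_le_pow_right (by norm_num) h2
  exact Nat.le_of_mul_le_mul_right h5 (by positivity)

/-- A property `Q` of almost every graph in a numerous class may be replaced by a property `P`
which follows from it up to few exceptions. -/
lemma AlmostEvery.of_few_exceptions {C Q P : ∀ n : ℕ, SimpleGraph (Fin n) → Prop}
    (h : AlmostEvery C Q) (B : ∀ n : ℕ, Set (SimpleGraph (Fin n)))
    (hB : ∀ n, (B n).ncard ≤ n ^ (2 * n))
    (hC : ∀ n, 2 ^ (n / 2 * (n - n / 2)) ≤ {G | C n G}.ncard)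
    (hP : ∀ n G, C n G → Q n G → P n G ∨ G ∈ B n) : AlmostEvery C P := by
  unfold AlmostEvery at h ⊢
  have hlim : Tendsto (fun n : ℕ => (1 / 2 : ℝ) ^ n) atTop (𝓝 0) :=
    tendsto_pow_atTop_nhds_zero_of_lt_one (by norm_num) (by norm_num)
  refine tendsto_of_tendsto_of_tendsto_of_le_of_le' (by simpa only [sub_zero] using h.sub hlim)
    tendsto_const_nhds ?_ (Eventually.of_forall fun n => ?_)
  · filter_upwards [eventually_pow_le] with n hn
    have hpos : (0 : ℝ) < ({G | C n G}.ncard : ℝ) := by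
      exact_mod_cast lt_of_lt_of_le (by positivity) (hC n)
    have hle : {G | C n G ∧ Q n G}.ncard ≤ {G | C n G ∧ P n G}.ncard + (B n).ncard := by
      refine (Set.ncard_le_ncard ?_ (Set.toFinite _)).trans (Set.ncard_union_le _ _)
      rintro G ⟨hG, hQ⟩
      exact (hP n G hG hQ).imp (fun h => ⟨hG, h⟩) id
    have hle' : ({G | C n G ∧ Q n G}.ncard : ℝ) ≤ {G | C n G ∧ P n G}.ncard + (B n).ncard := by
      exact_mod_cast hle
    have hfew : ((B n).ncard : ℝ) * 2 ^ n ≤ {G | C n G}.ncard := by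
      exact_mod_cast (Nat.mul_le_mul_right _ (hB n)).trans (hn.trans (hC n))
    rw [sub_le_iff_le_add, div_le_iff₀ hpos, add_mul,
      div_mul_cancel₀ _ hpos.ne']
    refine hle'.trans (add_le_add_right ?_ _)
    rw [one_div, inv_pow, inv_mul_eq_div, le_div_iff₀ (by positivity)]
    exact hfew
  · refine div_le_one_of_le₀ ?_ (by positivity)
    exact Nat.cast_le.2 (Set.ncard_le_ncard (fun G h => h.1) (Set.toFinite _))

theorem theorem4
    (h3K1 : AlmostEvery
      (fun _ G => IndFree (disjointCopies 3 (SimpleGraph.completeGraph (Fin 1))) G)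
      (fun _ G => G.chromaticNumber = (G.cliqueNum : ℕ∞)))
    (h2K2 : AlmostEvery
      (fun _ G => IndFree (disjointCopies 2 (SimpleGraph.completeGraph (Fin 2))) G)
      (fun _ G => G.chromaticNumber = (G.cliqueNum : ℕ∞)))
    (ℓ : ℕ) (hℓ : ℓ = 3 ∨ ℓ = 4) :
    AlmostEvery
      (fun _ G => IndFree (SimpleGraph.cycleGraph ℓ) G)
      (fun _ G => copNumber G < G.indepNum) := by
  rcases hℓ with rfl | rfl
  · refine (h3K1.exists_clique_cover complCycleThreeIso).of_few_exceptions
      (fun n => fewLinksGraphs (Fin n)) ncard_fewLinksGraphs_le two_pow_le_ncard_triangleFree ?_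
    rintro n G hG ⟨c, hc⟩
    rw [or_iff_not_imp_right]
    intro hbad
    by_contra hcop
    refine hbad (mem_fewLinksGraphs fun v x y z hx hy hz hxy hxz => ?_)
    by_contra hyz
    exact hcop (copNumber_lt_of_triangleFree c hc (indFree_cycleGraph_three_iff.1 hG) hx hy hz
      hxy hxz hyz)
  · refine (h2K2.exists_clique_cover complCycleFourIso).of_few_exceptions
      (fun n => kernelGraphs (Fin n)) ncard_kernelGraphs_le two_pow_le_ncard_c4Free ?_
    rintro n G hG ⟨c, hc⟩
    rw [or_iff_not_imp_right]
    intro hbad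
    by_contra hcop
    refine hbad (mem_kernelGraphs c hc fun x y hxy => ?_)
    by_contra hne
    exact hcop (copNumber_lt_of_c4Free c hc (indFree_cycleGraph_four_iff.1 hG) hxy hne)
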